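/- Let $N\in\mathbb N$ and let $A=(A_{ij})_{0\le i,j\le N-1}$ be an $N\times N$ matrix with entries in $\{0,1\}$ that is irreducible in the sense that there is $n\ge 1$ such that all entries of $A^n$ are positive. Let $$\Lambda_A=\{x=(x_k)_{k\ge 0}: x_k\in\{0,\dots,N-1\},\ A_{x_k x_{k+1}}=1 \text{ for all } k\}$$ be the space of admissible words, with the $\sigma$-algebra generated by the cylinder sets, let $\sigma:\Lambda_A\to\Lambda_A$, $\sigma(x_0x_1x_2\dots)=x_1x_2\dots$, be the one-sided shift, and let $R_i=\{x\in\Lambda_A: x_0=i\}$. Let $\pi:\Lambda_A\to[0,1]$, $\pi(x)=\sum_{k\ge0}x_kN^{-k-1}$, be the base-$N$ realization, let $\delta_A$ be the Hausdorff dimension of $\pi(\Lambda_A)$, let $\mathcal H^{\delta_A}$ be the $\delta_A$-dimensional Hausdorff measure on $\mathbb R$, and let $\mu_A$ be the normalized Hausdorff measure on $\Lambda_A$, $\mu_A(B)=\mathcal H^{\delta_A}(\pi(B))/\mathcal H^{\delta_A}(\pi(\Lambda_A))$ for measurable $B\subseteq\Lambda_A$. Then $\mu_A$ is a well-defined probability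 measure, the composition operator $T_\sigma\psi=\psi\circ\sigma$ is a well-defined bounded operator on $L^2(\Lambda_A,\mu_A)$ (complex-valued functions), and its adjoint, the Perron–Frobenius operator $\mathcal P_\sigma$ of $\sigma$, characterized by $$\int\overline{\psi}\,\mathcal P_\sigma(\xi)\,d\mu_A=\int\overline{T_\sigma(\psi)}\,\xi\,d\mu_A\qquad(\psi,\xi\in L^2(\Lambda_A,\mu_A)),$$ has the following fixed points. Let $\omega=(\omega_i)$ be a Perron–Frobenius eigenvector of the transpose $A^t$, i.e. $\omega\ne0$, $\omega_i\ge0$ for all $i$, and $A^t\omega=r(A^t)\,\omega$, where $r$ denotes the spectral radius. Then $f=\sum_i\omega_i\chi_{R_i}$ belongs to $L^2(\Lambda_A,\mu_A)$ and $$\mathcal P_\sigma f=f .$$ -/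

import Mathlib

open MeasureTheory
open scoped ENNReal Matrix

noncomputable section

namespace CuntzKrieger

variable {N : ℕ}

/-- The space `Λ_A` of infinite admissible words `x₀x₁x₂…` in the alphabet `{0, …, N-1}`,
with the σ-algebra generated by the cylinders (the Borel σ-algebra of the product topology). -/
abbrev Subshift (A : Matrix (Fin N) (Fin N) ℝ) : Type :=
  {x : ℕ → Fin N // ∀ n, A (x n) (x (n + 1)) = 1}

/-- The realization of `Λ_A` in `[0,1]`: the word `x₀x₁x₂…` goes to the number
`0.x₀x₁x₂… = ∑ₙ xₙ / N ^ (n + 1)` in base `N`. -/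
def toReal (A : Matrix (Fin N) (Fin N) ℝ) (x : Subshift A) : ℝ :=
  Real.ofDigits x.1

/-- The one-sided shift `σ(x₀x₁x₂…) = x₁x₂…`. -/
def shift (A : Matrix (Fin N) (Fin N) ℝ) (x : Subshift A) : Subshift A :=
  ⟨fun n => x.1 (n + 1), fun n => x.2 (n + 1)⟩

/-- The cylinder `R_i` of the words whose first letter is `i`. -/
def cylinder (A : Matrix (Fin N) (Fin N) ℝ) (i : Fin N) : Set (Subshift A) :=
  {x | x.1 0 = i}

/-- `δ_A`, the Hausdorff dimension of `Λ_A ⊆ [0,1]`. -/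
def hausdorffDim (A : Matrix (Fin N) (Fin N) ℝ) : ℝ :=
  (dimH (Set.range (toReal A))).toReal

/-- The `δ_A`-dimensional Hausdorff outer measure of `Λ_A ⊆ [0,1]`, read on words:
a set of words `s` is given the Hausdorff measure of its realization in `[0,1]`. -/
def hausdorffOuterMeasure (A : Matrix (Fin N) (Fin N) ℝ) : OuterMeasure (Subshift A) :=
  OuterMeasure.comap (toReal A) (Measure.hausdorffMeasure (X := ℝ) (hausdorffDim A)).toOuterMeasure

open Classical in
/-- The Hausdorff measure on the Borel sets of `Λ_A`. A number can have two admissible base-`N`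
expansions, so `Measure.comap`, which is restricted to injective maps, is not available; the outer
measure above is used instead. The value `0` is a default for the case that Borel sets are not
measurable for it. -/
def hausdorffMeasure (A : Matrix (Fin N) (Fin N) ℝ) : Measure (Subshift A) :=
  if h : (inferInstance : MeasurableSpace (Subshift A)) ≤ (hausdorffOuterMeasure A).caratheodory
  then (hausdorffOuterMeasure A).toMeasure h
  else 0

/-- `μ_A`, the Hausdorff measure normalized to total mass one. -/
def muA (A : Matrix (Fin N) (Fin N) ℝ) : Measure (Subshift A) :=
  (hausdorffMeasure A Set.univ)⁻¹ • hausdorffMeasure A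

section PerronFrobenius

variable {X : Type*} [MeasurableSpace X]

/-- `T` is the composition operator `T_σ ψ = ψ ∘ σ` on `L²(X, μ)`. The first component says that
`ψ ∘ σ` does not depend, up to null sets, on the representative of `ψ`. -/
def IsCompositionOperator (μ : Measure X) (σ : X → X) (T : Lp ℂ 2 μ →L[ℂ] Lp ℂ 2 μ) : Prop :=
  Measure.QuasiMeasurePreserving σ μ μ ∧
    ∀ ψ : Lp ℂ 2 μ, (T ψ : X → ℂ) =ᵐ[μ] fun x => ψ (σ x)

theorem IsCompositionOperator.unique {μ : Measure X} {σ : X → X}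
    {T T' : Lp ℂ 2 μ →L[ℂ] Lp ℂ 2 μ} (h : IsCompositionOperator μ σ T)
    (h' : IsCompositionOperator μ σ T') : T = T' := by
  ext1 ψ
  exact Lp.ext ((h.2 ψ).trans (h'.2 ψ).symm)

open Classical in
/-- The bounded composition operator `T_σ` on `L²(X, μ)` (and `0` if there is none). -/
def compositionOperator (μ : Measure X) (σ : X → X) : Lp ℂ 2 μ →L[ℂ] Lp ℂ 2 μ :=
  if h : ∃ T, IsCompositionOperator μ σ T then h.choose else 0

/-- The Perron–Frobenius operator `P_σ` on `L²(X, μ)`: the adjoint of `T_σ`, that is,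
`∫ conj(ψ) P_σ(ξ) dμ = ∫ conj(T_σ ψ) ξ dμ`. -/
def perronFrobeniusOperator (μ : Measure X) (σ : X → X) : Lp ℂ 2 μ →L[ℂ] Lp ℂ 2 μ :=
  ContinuousLinearMap.adjoint (compositionOperator μ σ)

end PerronFrobenius

/-- The spectral radius `r(B)`, the largest modulus of a complex eigenvalue of `B`. -/
def spectralRad (B : Matrix (Fin N) (Fin N) ℝ) : ℝ :=
  (spectralRadius ℂ (B.map (algebraMap ℝ ℂ))).toReal

/-- `v` is a Perron–Frobenius eigenvector of `B`: a nonzero vector with nonnegative entries that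
is an eigenvector for the eigenvalue `r(B)`. -/
def IsPerronFrobeniusEigenvector (B : Matrix (Fin N) (Fin N) ℝ) (v : Fin N → ℝ) : Prop :=
  v ≠ 0 ∧ (∀ i, 0 ≤ v i) ∧ B *ᵥ v = spectralRad B • v

/-- The function `∑ᵢ ωᵢ χ_{R_i}` on `Λ_A`. -/
def cylinderSum (A : Matrix (Fin N) (Fin N) ℝ) (ω : Fin N → ℝ) (x : Subshift A) : ℂ :=
  ∑ i, (ω i : ℂ) * (cylinder A i).indicator 1 x

end CuntzKrieger

end

namespace CuntzKrieger

open Filter Topology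

/-! Write `π` for the realization, `δ` for `δ_A`, `μ` for `μ_A`, and `ρ` for the eigenvalue of `ω`.
Prefixing the letter `i` acts on realizations as the contraction `y ↦ (i + y) / N`, so the scaling
and translation invariance of Hausdorff measure give `μ(σ⁻¹B ∩ R_i) = N^(-δ) μ(B ∩ {A i x₀ = 1})`.
Summing over `i` bounds the image of `μ` under `σ` by a multiple of `μ`, hence `T_σ` is bounded.
Summing with weights `ω i` puts the weight `N^(-δ) (Aᵀω) j = N^(-δ) ρ ω j` on `R_j`. If `N^δ = ρ`,
the measure `f μ` is therefore `σ`-invariant, and this is `P_σ f = f` after pairing with every `ψ`.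

It remains to show `N^δ = ρ` and that the Hausdorff measure of `π(Λ_A)` is positive and finite. For
`N > 1` put `d = log_N ρ`. A positive right eigenvector `v` counts coverings by `O(ρ^k)` intervals
of length `N^(-k)`, which gives finiteness in dimension `d`. It also yields a measure with mass at
most `ρ^(-k)` on cylinders of length `k`, and the mass distribution principle gives positivity. Both
together force `δ = d`. Of the spectral radius only its nonnegativity is needed: primitivity does
the rest.

Finally, `π` is injective off the words with realization in a countable set, which is null as soon
as `δ > 0`; this makes Borel sets Carathéodory measurable. -/

/-- The integer whose base-`N` expansion consists of the first `k` letters of `x`. -/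
def code {N : ℕ} (x : ℕ → Fin N) : ℕ → ℕ
  | 0 => 0
  | k + 1 => N * code x k + x k

/-- The sequence `x` preceded by the letter `i`. -/
def cons {N : ℕ} (i : Fin N) (x : ℕ → Fin N) : ℕ → Fin N
  | 0 => i
  | n + 1 => x n

/-! ### Base-`N` digits and integer codes of finite words. -/

section Code

variable {N : ℕ}

theorem code_cons (i : Fin N) (x : ℕ → Fin N) (k : ℕ) :
    code (cons i x) (k + 1) = i * N ^ k + code x k := by
  induction k with
  | zero => simp [code, cons]
  | succ k ih =>
    rw [code, ih]
    simp only [code, cons]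
    ring

theorem code_lt (x : ℕ → Fin N) (k : ℕ) : code x k < N ^ k := by
  induction k with
  | zero => simp [code]
  | succ k ih =>
    have := (x k).2
    simp only [code, pow_succ]
    nlinarith

theorem code_succ_mod (x : ℕ → Fin N) (k : ℕ) : code x (k + 1) % N = x k := by
  simp [code, Nat.mod_eq_of_lt (x k).2]

theorem pow_mul_sum_ofDigitsTerm (x : ℕ → Fin N) (k : ℕ) :
    (N : ℝ) ^ k * ∑ i ∈ Finset.range k, Real.ofDigitsTerm x i = code x k := by
  have hN : (N : ℝ) ≠ 0 := by
    have := Fin.pos (x 0)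
    positivity
  induction k with
  | zero => simp [code]
  | succ k ih =>
    rw [Finset.sum_range_succ, mul_add, pow_succ', mul_assoc, ih, Real.ofDigitsTerm, code]
    push_cast
    rw [pow_succ']
    field_simp

theorem pow_mul_ofDigits (x : ℕ → Fin N) (k : ℕ) :
    (N : ℝ) ^ k * Real.ofDigits x = code x k + Real.ofDigits (fun i => x (i + k)) := by
  have hN : (N : ℝ) ≠ 0 := by
    have := Fin.pos (x 0)
    positivity
  rw [Real.ofDigits_eq_sum_add_ofDigits x k, mul_add, pow_mul_sum_ofDigitsTerm]
  field_simp

theorem code_le_pow_mul_ofDigits (x : ℕ → Fin N) (k : ℕ) :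
    (code x k : ℝ) ≤ (N : ℝ) ^ k * Real.ofDigits x := by
  rw [pow_mul_ofDigits]
  linarith [Real.ofDigits_nonneg fun i => x (i + k)]

theorem pow_mul_ofDigits_le (x : ℕ → Fin N) (k : ℕ) :
    (N : ℝ) ^ k * Real.ofDigits x ≤ code x k + 1 := by
  rw [pow_mul_ofDigits]
  linarith [Real.ofDigits_le_one fun i => x (i + k)]

theorem ofDigits_cons (i : Fin N) (x : ℕ → Fin N) :
    Real.ofDigits (cons i x) = (N : ℝ)⁻¹ * (i + Real.ofDigits x) := by
  have hN : (N : ℝ) ≠ 0 := by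
    have := Fin.pos i
    positivity
  have h := pow_mul_ofDigits (cons i x) 1
  have hx : (fun j => cons i x (j + 1)) = x := rfl
  rw [hx] at h
  simp only [pow_one, code, cons, mul_zero, zero_add] at h
  rw [← h]
  field_simp

/-- The real numbers with a finite base-`N` expansion. -/
def gridPoints (N : ℕ) : Set ℝ := {y | ∃ k m : ℕ, (N : ℝ) ^ k * y = m}

theorem countable_gridPoints (hN : N ≠ 0) : (gridPoints N).Countable := by
  have : gridPoints N ⊆ Set.range fun p : ℕ × ℕ => (p.2 : ℝ) / (N : ℝ) ^ p.1 := by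
    rintro y ⟨k, m, h⟩
    refine ⟨(k, m), ?_⟩
    have : (N : ℝ) ≠ 0 := by exact_mod_cast hN
    simp only
    rw [← h]
    field_simp
  exact (Set.countable_range _).mono this

/-- Off the grid the bound `N^k y ≤ code + 1` is strict. The letters are thus recovered from the
real number by a Borel function. -/
theorem floor_pow_mul_ofDigits (x : ℕ → Fin N) (hx : Real.ofDigits x ∉ gridPoints N) (k : ℕ) :
    ⌊(N : ℝ) ^ k * Real.ofDigits x⌋₊ = code x k := by
  have h := code_le_pow_mul_ofDigits x k
  rw [Nat.floor_eq_iff (le_trans (by positivity) h)]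
  refine ⟨h, lt_of_le_of_ne (pow_mul_ofDigits_le x k) fun h' => hx ⟨k, code x k + 1, ?_⟩⟩
  rw [h']
  push_cast
  rfl

theorem continuous_code (k : ℕ) : Continuous fun x : ℕ → Fin N => code x k := by
  induction k with
  | zero => exact continuous_const
  | succ k ih =>
    have h : Continuous fun p : ℕ × Fin N => N * p.1 + p.2 := continuous_of_discreteTopology
    exact h.comp (ih.prodMk (continuous_apply k))

theorem continuous_cons (i : Fin N) : Continuous (cons i) := by
  refine continuous_pi fun n => ?_
  cases n with
  | zero => exact continuous_const
  | succ n => exact continuous_apply n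

end Code

/-! ### Perron–Frobenius facts for primitive matrices. -/

section Perron

variable {N : ℕ} {A : Matrix (Fin N) (Fin N) ℝ} {ρ : ℝ}

theorem pow_mulVec_of_mulVec_eq {v : Fin N → ℝ} (h : A *ᵥ v = ρ • v) (n : ℕ) :
    (A ^ n) *ᵥ v = ρ ^ n • v := by
  induction n with
  | zero => simp
  | succ n ih => rw [pow_succ, ← Matrix.mulVec_mulVec, h, Matrix.mulVec_smul, ih, smul_smul, pow_succ']

theorem pos_of_mulVec_eq {n : ℕ} (hn : 0 < n) (hpos : ∀ i j, 0 < (A ^ n) i j) {v : Fin N → ℝ}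
    (hv0 : v ≠ 0) (hv : ∀ i, 0 ≤ v i) (hρ : 0 ≤ ρ) (h : A *ᵥ v = ρ • v) :
    0 < ρ ∧ ∀ i, 0 < v i := by
  obtain ⟨j, hj⟩ := Function.ne_iff.1 hv0
  have key : ∀ i, 0 < ρ ^ n * v i := fun i => by
    have := congrFun (pow_mulVec_of_mulVec_eq h n) i
    simp only [Pi.smul_apply, smul_eq_mul] at this
    rw [← this]
    refine Finset.sum_pos' (fun k _ => mul_nonneg (hpos i k).le (hv k)) ⟨j, Finset.mem_univ _, ?_⟩
    exact mul_pos (hpos i j) ((hv j).lt_of_ne' hj)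
  constructor
  · refine hρ.lt_of_ne' fun h0 => ?_
    have := key j
    simp [h0, hn.ne'] at this
  · intro i
    exact pos_of_mul_pos_right (key i) (pow_nonneg hρ n)

/-- A positive left eigenvector of a primitive matrix comes with a positive right eigenvector for
the same eigenvalue. -/
theorem exists_pos_eigenvector (hA : ∀ i j, 0 ≤ A i j) {n : ℕ} (hn : 0 < n)
    (hpos : ∀ i j, 0 < (A ^ n) i j) {ω : Fin N → ℝ} (hω0 : ω ≠ 0) (hω : ∀ i, 0 < ω i)
    (hρ : 0 ≤ ρ) (h : Aᵀ *ᵥ ω = ρ • ω) :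
    ∃ v : Fin N → ℝ, (∀ i, 0 < v i) ∧ ∑ i, v i = 1 ∧ A *ᵥ v = ρ • v := by
  have hdet : (Aᵀ - ρ • (1 : Matrix (Fin N) (Fin N) ℝ)).det = 0 := by
    refine Matrix.exists_mulVec_eq_zero_iff.1 ⟨ω, hω0, ?_⟩
    rw [Matrix.sub_mulVec, h, Matrix.smul_mulVec, Matrix.one_mulVec, sub_self]
  have hdet' : (A - ρ • (1 : Matrix (Fin N) (Fin N) ℝ)).det = 0 := by
    rw [← Matrix.det_transpose, Matrix.transpose_sub, Matrix.transpose_smul, Matrix.transpose_one]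
    exact hdet
  obtain ⟨u, hu0, hu⟩ := Matrix.exists_mulVec_eq_zero_iff.2 hdet'
  rw [Matrix.sub_mulVec, Matrix.smul_mulVec, Matrix.one_mulVec, sub_eq_zero] at hu
  have hle : ∀ i, ρ * |u i| ≤ ∑ j, A i j * |u j| := fun i => by
    have hi : ∑ j, A i j * u j = ρ * u i := congrFun hu i
    calc ρ * |u i| = |∑ j, A i j * u j| := by rw [hi, abs_mul, abs_of_nonneg hρ]
      _ ≤ ∑ j, |A i j * u j| := Finset.abs_sum_le_sum_abs _ _
      _ = _ := Finset.sum_congr rfl fun j _ => by rw [abs_mul, abs_of_nonneg (hA i j)]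
  -- By the triangle inequality `|u|` satisfies `ρ|u| ≤ A|u|`. The defect is nonnegative and pairs
  -- to zero with the positive left eigenvector `ω`, so it vanishes.
  have hsum : ∑ i, ω i * (∑ j, A i j * |u j| - ρ * |u i|) = 0 := by
    have h1 : ∑ i, ω i * ∑ j, A i j * |u j| = ∑ j, (ρ * ω j) * |u j| := by
      simp_rw [Finset.mul_sum]
      rw [Finset.sum_comm]
      refine Finset.sum_congr rfl fun j _ => ?_
      have : ∑ i, A i j * ω i = ρ * ω j := congrFun h j
      rw [← this, Finset.sum_mul]
      exact Finset.sum_congr rfl fun i _ => by ring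
    simp_rw [mul_sub, Finset.sum_sub_distrib, h1]
    rw [sub_eq_zero]
    exact Finset.sum_congr rfl fun i _ => by ring
  have habs : A *ᵥ (fun i => |u i|) = ρ • fun i => |u i| := by
    ext i
    have := (Finset.sum_eq_zero_iff_of_nonneg fun i _ =>
      mul_nonneg (hω i).le (sub_nonneg.2 (hle i))).1 hsum i (Finset.mem_univ i)
    rcases mul_eq_zero.1 this with h' | h'
    · exact absurd h' (hω i).ne'
    · exact sub_eq_zero.1 h'
  have hne : (fun i => |u i|) ≠ 0 := fun h0 => hu0 <| by
    ext i
    simpa using congrFun h0 i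
  obtain ⟨-, hp⟩ := pos_of_mulVec_eq hn hpos hne (fun i => abs_nonneg _) hρ habs
  obtain ⟨j, -⟩ := Function.ne_iff.1 hu0
  have hS : 0 < ∑ i, |u i| := Finset.sum_pos (fun i _ => hp i) ⟨j, Finset.mem_univ _⟩
  refine ⟨(∑ i, |u i|)⁻¹ • fun i => |u i|, fun i => ?_, ?_, ?_⟩
  · exact mul_pos (inv_pos.2 hS) (hp i)
  · simp only [Pi.smul_apply, smul_eq_mul]
    rw [← Finset.mul_sum, inv_mul_cancel₀ hS.ne']
  · rw [Matrix.mulVec_smul, habs, smul_comm]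

/-- The entries of `A ^ n` are positive integers, hence at least `1`, so `ρ ^ n * v i` is at least
the sum of all `v j`, which exceeds `v i` when there are two letters. -/
theorem one_lt_of_mulVec_eq (hA : ∀ i j, A i j = 0 ∨ A i j = 1) {n : ℕ}
    (hpos : ∀ i j, 0 < (A ^ n) i j) (hN : 1 < N) (hρ : 0 ≤ ρ) {v : Fin N → ℝ}
    (hv : ∀ i, 0 < v i) (h : A *ᵥ v = ρ • v) : 1 < ρ := by
  have hnat : ∀ m i j, ∃ a : ℕ, (A ^ m) i j = a := fun m => by
    induction m with
    | zero =>
      intro i j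
      by_cases hij : i = j
      · exact ⟨1, by simp [hij]⟩
      · exact ⟨0, by simp [hij]⟩
    | succ m ih =>
      intro i j
      choose a ha using ih
      choose b hb using fun i j => show ∃ b : ℕ, A i j = b from
        (hA i j).elim (fun h => ⟨0, by simp [h]⟩) (fun h => ⟨1, by simp [h]⟩)
      exact ⟨∑ k, a i k * b k j, by simp [pow_succ, Matrix.mul_apply, ha, hb]⟩
  have hone : ∀ i j, 1 ≤ (A ^ n) i j := fun i j => by
    obtain ⟨a, ha⟩ := hnat n i j
    have := hpos i j
    rw [ha] at this ⊢
    exact_mod_cast this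
  have hlt : ∀ i, v i < ρ ^ n * v i := fun i => by
    have := congrFun (pow_mulVec_of_mulVec_eq h n) i
    simp only [Pi.smul_apply, smul_eq_mul] at this
    rw [← this]
    calc v i < ∑ j, v j := by
          obtain ⟨j, hj⟩ : ∃ j : Fin N, j ≠ i := by
            have : Nontrivial (Fin N) := Fin.nontrivial_iff_two_le.2 hN
            exact exists_ne i
          exact Finset.single_lt_sum hj (Finset.mem_univ i) (Finset.mem_univ j) (hv j)
            fun k _ _ => (hv k).le
      _ ≤ ∑ j, (A ^ n) i j * v j := Finset.sum_le_sum fun j _ =>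
          le_mul_of_one_le_left (hv j).le (hone i j)
  have i₀ : Fin N := ⟨0, by omega⟩
  by_contra hle
  have h1 : ρ ^ n ≤ 1 := pow_le_one₀ hρ (not_lt.1 hle)
  have := hlt i₀
  nlinarith [hv i₀]

theorem exists_eq_one_of_pow_pos (hA : ∀ i j, A i j = 0 ∨ A i j = 1) {n : ℕ} (hn : 0 < n)
    (hpos : ∀ i j, 0 < (A ^ n) i j) (i : Fin N) : ∃ j, A i j = 1 := by
  by_contra! hne
  have h0 : ∀ j, A i j = 0 := fun j => (hA i j).resolve_right (hne j)
  obtain ⟨m, rfl⟩ := Nat.exists_eq_succ_of_ne_zero hn.ne'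
  have := hpos i i
  rw [pow_succ', Matrix.mul_apply] at this
  simp [h0] at this

end Perron

/-! ### A Markov measure on the admissible words. -/

/-- The admissible words, as a subset of the full shift. -/
def admissible {N : ℕ} (A : Matrix (Fin N) (Fin N) ℝ) : Set (ℕ → Fin N) :=
  {x | ∀ n, A (x n) (x (n + 1)) = 1}

/-- The dual of the transfer operator `h ↦ ρ⁻¹ ∑ᵢ A i (x 0) h (i x)`. -/
noncomputable def transferMeasure {N : ℕ} (A : Matrix (Fin N) (Fin N) ℝ) (ρ : ℝ)
    (ν : Measure (ℕ → Fin N)) : Measure (ℕ → Fin N) :=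
  ∑ i, ENNReal.ofReal ρ⁻¹ • (ν.restrict {x | A i (x 0) = 1}).map (cons i)

section Markov

variable {N : ℕ} {A : Matrix (Fin N) (Fin N) ℝ} {ρ : ℝ} {v : Fin N → ℝ}

theorem measurableSet_letter (k : ℕ) (p : Fin N → Prop) :
    MeasurableSet {x : ℕ → Fin N | p (x k)} :=
  (measurable_pi_apply k) (MeasurableSet.of_discrete (s := {i | p i}))

theorem isClosed_admissible : IsClosed (admissible A) := by
  have : admissible A = ⋂ n, {x : ℕ → Fin N | A (x n) (x (n + 1)) = 1} := by
    ext x; simp [admissible]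
  rw [this]
  refine isClosed_iInter fun n => ?_
  exact (isClosed_discrete {p : Fin N × Fin N | A p.1 p.2 = 1}).preimage
    (f := fun x : ℕ → Fin N => (x n, x (n + 1))) (by fun_prop)

theorem cons_mem_admissible {i : Fin N} {x : ℕ → Fin N} (hx : x ∈ admissible A)
    (hi : A i (x 0) = 1) : cons i x ∈ admissible A := fun n => by
  cases n with
  | zero => exact hi
  | succ n => exact hx n

theorem exists_mem_admissible (h : ∀ i, ∃ j, A i j = 1) (i : Fin N) :
    ∃ x ∈ admissible A, x 0 = i := by
  choose g hg using h
  refine ⟨fun n => g^[n] i, fun n => ?_, rfl⟩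
  simp only [Function.iterate_succ_apply']
  exact hg _

theorem range_toReal : Set.range (toReal A) = Real.ofDigits '' admissible A := by
  ext y
  constructor
  · rintro ⟨x, rfl⟩
    exact ⟨x.1, x.2, rfl⟩
  · rintro ⟨x, hx, rfl⟩
    exact ⟨⟨x, hx⟩, rfl⟩

theorem transferMeasure_apply (ν : Measure (ℕ → Fin N)) {E : Set (ℕ → Fin N)}
    (hE : MeasurableSet E) : transferMeasure A ρ ν E =
      ∑ i, ENNReal.ofReal ρ⁻¹ * ν (cons i ⁻¹' E ∩ {x | A i (x 0) = 1}) := by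
  simp only [transferMeasure, Measure.coe_finsetSum, Finset.sum_apply, Measure.smul_apply,
    smul_eq_mul]
  refine Finset.sum_congr rfl fun i _ => ?_
  have hc : Measurable (cons i) := (continuous_cons i).measurable
  rw [Measure.map_apply hc hE, Measure.restrict_apply (hc hE)]

theorem measure_letter (ν : Measure (ℕ → Fin N)) (p : Fin N → Prop) [DecidablePred p] :
    ν {x | p (x 0)} = ∑ j with p j, ν {x | x 0 = j} := by
  rw [← measure_biUnion_finset]
  · congr 1
    ext x
    simp
  · intro i _ j _ hij
    exact Set.disjoint_left.2 fun x hx hx' => hij (hx.symm.trans hx')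
  · exact fun j _ => measurableSet_letter 0 (· = j)

/-- The equation `A v = ρ v` says exactly that the masses `v i` of the one-letter cylinders are
unchanged by the transfer, so it can be iterated. -/
theorem transferMeasure_letter (hA : ∀ i j, A i j = 0 ∨ A i j = 1) (hρ : 0 < ρ)
    (hv : ∀ i, 0 < v i) (h : A *ᵥ v = ρ • v) {ν : Measure (ℕ → Fin N)}
    (hν : ∀ i, ν {x | x 0 = i} = ENNReal.ofReal (v i)) (i : Fin N) :
    transferMeasure A ρ ν {x | x 0 = i} = ENNReal.ofReal (v i) := by
  classical
  rw [transferMeasure_apply _ (measurableSet_letter 0 (· = i)), Finset.sum_eq_single i]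
  · have : cons i ⁻¹' {x | x 0 = i} = Set.univ := by
      ext x; simp [cons]
    rw [this, Set.univ_inter, measure_letter ν fun j => A i j = 1]
    simp_rw [hν]
    rw [← ENNReal.ofReal_sum_of_nonneg fun j _ => (hv j).le, ← ENNReal.ofReal_mul (by positivity)]
    congr 1
    have hi : ∑ j, A i j * v j = ρ * v i := congrFun h i
    have : ∑ j with A i j = 1, v j = ρ * v i := by
      rw [← hi, Finset.sum_filter]
      refine Finset.sum_congr rfl fun j _ => ?_
      rcases hA i j with h0 | h1
      · simp [h0]
      · simp [h1]
    rw [this, inv_mul_cancel_left₀ hρ.ne']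
  · intro j _ hj
    have : cons j ⁻¹' {x | x 0 = i} = ∅ := by
      ext x; simp [cons, hj]
    simp [this]
  · simp

theorem transferMeasure_compl_admissible {ν : Measure (ℕ → Fin N)}
    (hν : ν (admissible A)ᶜ = 0) : transferMeasure A ρ ν (admissible A)ᶜ = 0 := by
  rw [transferMeasure_apply _ isClosed_admissible.measurableSet.compl]
  refine Finset.sum_eq_zero fun i _ => ?_
  rw [measure_mono_null _ hν, mul_zero]
  rintro x ⟨hx, hi⟩ hadm
  exact hx (cons_mem_admissible hadm hi)

theorem measurableSet_code (k m : ℕ) : MeasurableSet {x : ℕ → Fin N | code x k = m} :=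
  (continuous_code k).measurable (measurableSet_singleton m)

/-- The leading digit `m / N ^ k` determines the prefixed letter, so at most one summand survives
and each transfer gains one factor `ρ⁻¹`. -/
theorem transferMeasure_code_le {ν : Measure (ℕ → Fin N)} {k : ℕ} {c : ℝ≥0∞}
    (hν : ∀ m, ν {x | code x k = m} ≤ c) (m : ℕ) :
    transferMeasure A ρ ν {x | code x (k + 1) = m} ≤ ENNReal.ofReal ρ⁻¹ * c := by
  rw [transferMeasure_apply _ (measurableSet_code _ _)]
  have hsub : ∀ i : Fin N, ∀ x ∈ cons i ⁻¹' {x | code x (k + 1) = m},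
      (i : ℕ) = m / N ^ k ∧ code x k = m % N ^ k := fun i x hx => by
    simp only [Set.mem_preimage, Set.mem_ofPred_eq, code_cons] at hx
    have hlt := code_lt x k
    have hpos : 0 < N ^ k := by omega
    rw [← hx, mul_comm, Nat.mul_add_div hpos, Nat.mul_add_mod, Nat.div_eq_of_lt hlt,
      Nat.mod_eq_of_lt hlt]
    simp
  by_cases hi : ∃ i : Fin N, (i : ℕ) = m / N ^ k
  · obtain ⟨i, hi⟩ := hi
    rw [Finset.sum_eq_single i]
    · gcongr
      exact (measure_mono fun x hx => (hsub i x hx.1).2).trans (hν (m % N ^ k))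
    · intro j _ hj
      rw [measure_mono_null (t := ∅) _ measure_empty, mul_zero]
      exact fun x hx => hj (Fin.ext ((hsub j x hx.1).1.trans hi.symm))
    · simp
  · rw [Finset.sum_eq_zero]
    · exact zero_le
    · intro j _
      rw [measure_mono_null (t := ∅) _ measure_empty, mul_zero]
      exact fun x hx => hi ⟨j, (hsub j x hx.1).1⟩

theorem isProbabilityMeasure_of_letter (hv : ∀ i, 0 < v i) (hsum : ∑ i, v i = 1)
    {ν : Measure (ℕ → Fin N)} (hν : ∀ i, ν {x | x 0 = i} = ENNReal.ofReal (v i)) :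
    IsProbabilityMeasure ν := by
  classical
  constructor
  have := measure_letter ν fun _ => True
  simp only [Set.ofPred_true, Finset.filter_true, hν] at this
  rw [this, ← ENNReal.ofReal_sum_of_nonneg fun j _ => (hv j).le, hsum, ENNReal.ofReal_one]

/-- Start from weighted point masses, one admissible word per first letter, and apply the transfer
`n` times. The bound holds only up to length `n`; a weak limit removes this restriction. -/
theorem exists_approx_markovMeasure (hA : ∀ i j, A i j = 0 ∨ A i j = 1)
    (hrow : ∀ i, ∃ j, A i j = 1) (hρ : 0 < ρ) (hv : ∀ i, 0 < v i) (hsum : ∑ i, v i = 1)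
    (h : A *ᵥ v = ρ • v) (n : ℕ) :
    ∃ ν : Measure (ℕ → Fin N), (∀ i, ν {x | x 0 = i} = ENNReal.ofReal (v i)) ∧
      ν (admissible A)ᶜ = 0 ∧
      ∀ k ≤ n, ∀ m, ν {x | code x k = m} ≤ ENNReal.ofReal ρ⁻¹ ^ k := by
  classical
  induction n with
  | zero =>
    choose s hs hs0 using exists_mem_admissible hrow
    have hl : ∀ i, (∑ j, ENNReal.ofReal (v j) • Measure.dirac (s j)) {x | x 0 = i} =
        ENNReal.ofReal (v i) := fun i => by
      simp only [Measure.coe_finsetSum, Finset.sum_apply, Measure.smul_apply, smul_eq_mul]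
      rw [Finset.sum_eq_single i]
      · simp [Measure.dirac_apply' _ (measurableSet_letter 0 (· = i)), hs0]
      · intro j _ hj
        simp [Measure.dirac_apply' _ (measurableSet_letter 0 (· = i)), hs0, hj]
      · simp
    refine ⟨∑ i, ENNReal.ofReal (v i) • Measure.dirac (s i), hl, ?_, ?_⟩
    · simp only [Measure.coe_finsetSum, Finset.sum_apply, Measure.smul_apply, smul_eq_mul]
      refine Finset.sum_eq_zero fun i _ => ?_
      simp [Measure.dirac_apply' _ isClosed_admissible.measurableSet.compl, hs]
    · intro k hk m
      have := isProbabilityMeasure_of_letter hv hsum hl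
      rw [Nat.le_zero.1 hk, pow_zero]
      exact prob_le_one
  | succ n ih =>
    obtain ⟨ν, hl, hadm, hcode⟩ := ih
    refine ⟨transferMeasure A ρ ν, transferMeasure_letter hA hρ hv h hl,
      transferMeasure_compl_admissible hadm, fun k hk m => ?_⟩
    cases k with
    | zero =>
      have := isProbabilityMeasure_of_letter hv hsum (transferMeasure_letter hA hρ hv h hl)
      rw [pow_zero]
      exact prob_le_one
    | succ k =>
      rw [pow_succ']
      exact transferMeasure_code_le (hcode k (by omega)) m

/-- A probability measure on the admissible words that gives mass at most `ρ⁻ᵏ` to the cylinders of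
length `k`. -/
theorem exists_markovMeasure (hA : ∀ i j, A i j = 0 ∨ A i j = 1)
    (hrow : ∀ i, ∃ j, A i j = 1) (hρ : 0 < ρ) (hv : ∀ i, 0 < v i) (hsum : ∑ i, v i = 1)
    (h : A *ᵥ v = ρ • v) :
    ∃ ν : Measure (ℕ → Fin N), IsProbabilityMeasure ν ∧ ν (admissible A) = 1 ∧
      ∀ k m, ν {x | code x k = m} ≤ ENNReal.ofReal ρ⁻¹ ^ k := by
  choose ν hl hadm hcode using exists_approx_markovMeasure hA hrow hρ hv hsum h
  let P : ℕ → ProbabilityMeasure (ℕ → Fin N) := fun n =>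
    ⟨ν n, isProbabilityMeasure_of_letter hv hsum (hl n)⟩
  -- Probability measures on the compact full shift form a compact space, so a limit along an
  -- ultrafilter exists. Both properties survive, as the inadmissible words form an open set and the
  -- code sets are clopen.
  obtain ⟨Q, -, hQ⟩ := isCompact_univ (X := ProbabilityMeasure (ℕ → Fin N)).ultrafilter_le_nhds
    ((hyperfilter ℕ : Ultrafilter ℕ).map P) (by simp)
  have hlim : Tendsto P (hyperfilter ℕ) (𝓝 Q) := hQ
  refine ⟨Q, inferInstance, ?_, fun k m => ?_⟩
  · rw [← prob_compl_eq_zero_iff isClosed_admissible.measurableSet]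
    have := ProbabilityMeasure.le_liminf_measure_open_of_tendsto hlim
      (isClosed_admissible (A := A)).isOpen_compl
    simpa [P, hadm] using this
  · have hclopen : IsClopen {x : ℕ → Fin N | code x k = m} :=
      (isClopen_discrete {m}).preimage (continuous_code k)
    have := ProbabilityMeasure.tendsto_measure_of_null_frontier_of_tendsto' hlim
      (E := {x : ℕ → Fin N | code x k = m}) (by simp [hclopen.frontier_eq])
    refine le_of_tendsto this ?_
    have hge : ∀ᶠ n in (hyperfilter ℕ : Filter ℕ), k ≤ n :=
      (Nat.hyperfilter_le_atTop) (eventually_ge_atTop k)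
    filter_upwards [hge] with n hn
    exact hcode n k hn m

end Markov

/-! ### Positive and finite Hausdorff measure in dimension `log_N ρ`. -/

section Dimension

variable {N : ℕ} {A : Matrix (Fin N) (Fin N) ℝ} {ρ : ℝ} {v : Fin N → ℝ}

theorem measurable_ofDigits : Measurable (Real.ofDigits : (ℕ → Fin N) → ℝ) :=
  Real.continuous_ofDigits.measurable

theorem map_ofDigits_closedBall_le (hN : 0 < N) {ν : Measure (ℕ → Fin N)} {k : ℕ} {q : ℝ≥0∞}
    (hν : ∀ m, ν {x | code x k = m} ≤ q) (y : ℝ) :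
    ν.map Real.ofDigits (Metric.closedBall y ((N : ℝ) ^ k)⁻¹) ≤ 4 * q := by
  rw [Measure.map_apply measurable_ofDigits Metric.isClosed_closedBall.measurableSet]
  -- The code of a word realized in the ball is an integer between `N^k y - 2` and `N^k y + 1`,
  -- hence one of `a, …, a + 3`; this is the source of the constant `4`.
  set a : ℤ := ⌈(N : ℝ) ^ k * y⌉ - 2
  have hsub : Real.ofDigits ⁻¹' Metric.closedBall y ((N : ℝ) ^ k)⁻¹ ⊆
      ⋃ j ∈ Finset.range 4, {x : ℕ → Fin N | code x k = (a + j).toNat} := fun x hx => by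
    rw [Set.mem_preimage, Metric.mem_closedBall, Real.dist_eq, abs_le] at hx
    have hpos : (0 : ℝ) < (N : ℝ) ^ k := by positivity
    have h1 : (N : ℝ) ^ k * y - 1 ≤ (N : ℝ) ^ k * Real.ofDigits x := by
      have := mul_le_mul_of_nonneg_left hx.1 hpos.le
      rw [mul_neg, mul_inv_cancel₀ hpos.ne'] at this
      linarith
    have h2 : (N : ℝ) ^ k * Real.ofDigits x ≤ (N : ℝ) ^ k * y + 1 := by
      have := mul_le_mul_of_nonneg_left hx.2 hpos.le
      rw [mul_inv_cancel₀ hpos.ne'] at this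
      linarith
    have h3 := code_le_pow_mul_ofDigits x k
    have h4 := pow_mul_ofDigits_le x k
    have h5 : a ≤ code x k := by
      have : ⌈(N : ℝ) ^ k * y⌉ ≤ code x k + 2 := Int.ceil_le.2 (by push_cast; linarith)
      omega
    have h6 : (code x k : ℤ) ≤ a + 3 := by
      have h : (code x k : ℝ) ≤ ⌈(N : ℝ) ^ k * y⌉ + 1 := by
        linarith [Int.le_ceil ((N : ℝ) ^ k * y)]
      have : (code x k : ℤ) ≤ ⌈(N : ℝ) ^ k * y⌉ + 1 := by exact_mod_cast h
      omega
    simp only [Set.mem_iUnion, Finset.mem_range, Set.mem_ofPred_eq, exists_prop]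
    exact ⟨(code x k - a).toNat, by omega, by omega⟩
  calc _ ≤ _ := measure_mono hsub
    _ ≤ ∑ j ∈ Finset.range 4, ν {x | code x k = (a + j).toNat} := measure_biUnion_finset_le _ _
    _ ≤ ∑ j ∈ Finset.range 4, q := Finset.sum_le_sum fun j _ => hν _
    _ = 4 * q := by simp

/-- The mass distribution principle for the Markov measure. -/
theorem map_ofDigits_le_diam_rpow (hN : 1 < N) (hρ : 1 < ρ) {d : ℝ} (hd : 0 < d)
    (hNd : (N : ℝ) ^ d = ρ) {ν : Measure (ℕ → Fin N)}
    (hν : ∀ k m, ν {x | code x k = m} ≤ ENNReal.ofReal ρ⁻¹ ^ k) {s : Set ℝ}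
    (hs : Metric.ediam s ≤ 1) :
    ν.map Real.ofDigits s ≤ ENNReal.ofReal (4 * ρ) * Metric.ediam s ^ d := by
  have hN0 : (0 : ℝ) < N := by positivity
  have hρ0 : 0 < ρ := by linarith
  obtain rfl | ⟨y, hy⟩ := s.eq_empty_or_nonempty
  · simp
  have hball : ∀ k : ℕ, Metric.ediam s ≤ ENNReal.ofReal ((N : ℝ) ^ k)⁻¹ →
      ν.map Real.ofDigits s ≤ 4 * ENNReal.ofReal ρ⁻¹ ^ k := fun k hk => by
    refine (measure_mono fun z hz => ?_).trans (map_ofDigits_closedBall_le (by omega) (hν k) y)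
    rw [Metric.mem_closedBall, ← edist_le_ofReal (by positivity)]
    exact (Metric.edist_le_ediam_of_mem hz hy).trans hk
  have hq : ENNReal.ofReal ρ⁻¹ < 1 := by
    rw [ENNReal.ofReal_lt_one]
    exact inv_lt_one_of_one_lt₀ hρ
  by_cases h0 : Metric.ediam s = 0
  · have hlim : Tendsto (fun k : ℕ => 4 * ENNReal.ofReal ρ⁻¹ ^ k) atTop (𝓝 (4 * 0)) :=
      ENNReal.Tendsto.const_mul (ENNReal.tendsto_pow_atTop_nhds_zero_of_lt_one hq)
        (Or.inr (by simp))
    rw [mul_zero] at hlim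
    exact (ge_of_tendsto' hlim fun k => hball k (by simp [h0])).trans zero_le
  · have htop : Metric.ediam s ≠ ∞ := (hs.trans_lt ENNReal.one_lt_top).ne
    have hD0 : 0 < (Metric.ediam s).toReal := ENNReal.toReal_pos h0 htop
    have hD1 : (Metric.ediam s).toReal ≤ 1 := ENNReal.toReal_le_of_le_ofReal zero_le_one (by simpa)
    -- Choose the scale with `N^(-(k+1)) < diam s ≤ N^(-k)`. Passing from `k` to `k + 1` costs the
    -- factor `ρ` in the constant `4 * ρ`.
    obtain ⟨k, hk1, hk2⟩ := exists_nat_pow_near_of_lt_one hD0 hD1 (inv_pos.2 hN0)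
      (inv_lt_one_of_one_lt₀ (by exact_mod_cast hN))
    refine (hball k ?_).trans ?_
    · rw [← ENNReal.ofReal_toReal htop, ← inv_pow]
      exact ENNReal.ofReal_le_ofReal hk2
    · have hpow : (ρ⁻¹) ^ (k + 1) ≤ (Metric.ediam s).toReal ^ d := by
        calc (ρ⁻¹) ^ (k + 1) = (((N : ℝ)⁻¹) ^ (k + 1)) ^ d := by
              rw [← hNd, ← Real.inv_rpow hN0.le, ← Real.rpow_natCast, ← Real.rpow_natCast,
                ← Real.rpow_mul (by positivity), ← Real.rpow_mul (by positivity), mul_comm]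
          _ ≤ _ := Real.rpow_le_rpow (by positivity) hk1.le hd.le
      rw [← ENNReal.ofReal_toReal htop, ENNReal.ofReal_rpow_of_pos hD0,
        ← ENNReal.ofReal_mul (by positivity), ← ENNReal.ofReal_pow (by positivity),
        show (4 : ℝ≥0∞) = ENNReal.ofReal 4 by simp, ← ENNReal.ofReal_mul (by positivity)]
      refine ENNReal.ofReal_le_ofReal ?_
      calc 4 * ρ⁻¹ ^ k = 4 * ρ * ρ⁻¹ ^ (k + 1) := by rw [pow_succ]; field_simp
        _ ≤ _ := by gcongr

theorem hausdorffMeasure_range_ne_zero (hA : ∀ i j, A i j = 0 ∨ A i j = 1)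
    (hrow : ∀ i, ∃ j, A i j = 1) (hN : 1 < N) (hρ : 1 < ρ) {d : ℝ} (hd : 0 < d)
    (hNd : (N : ℝ) ^ d = ρ) (hv : ∀ i, 0 < v i) (hsum : ∑ i, v i = 1) (h : A *ᵥ v = ρ • v) :
    Measure.hausdorffMeasure d (Set.range (toReal A)) ≠ 0 := by
  obtain ⟨ν, -, hadm, hcode⟩ := exists_markovMeasure hA hrow (by linarith) hv hsum h
  have hc0 : ENNReal.ofReal (4 * ρ) ≠ 0 := (ENNReal.ofReal_pos.2 (by linarith)).ne'
  have hle : (ENNReal.ofReal (4 * ρ))⁻¹ • ν.map Real.ofDigits ≤ Measure.hausdorffMeasure d := by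
    refine Measure.le_hausdorffMeasure d _ 1 one_pos fun s hs => ?_
    rw [Measure.smul_apply, smul_eq_mul, ENNReal.inv_mul_le_iff hc0 ENNReal.ofReal_ne_top]
    exact map_ofDigits_le_diam_rpow hN hρ hd hNd hcode hs
  have h1 : 1 ≤ ν.map Real.ofDigits (Set.range (toReal A)) := by
    rw [← hadm, range_toReal]
    exact (measure_mono (Set.subset_preimage_image _ _)).trans
      (Measure.le_map_apply measurable_ofDigits.aemeasurable _)
  refine (lt_of_lt_of_le ?_ (hle (Set.range (toReal A)))).ne'
  rw [Measure.smul_apply, smul_eq_mul]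
  exact ENNReal.mul_pos (ENNReal.inv_ne_zero.2 ENNReal.ofReal_ne_top)
    (one_pos.trans_le h1).ne'

/-- The admissible words are covered by at most `C ρᵏ` intervals of length `N⁻ᵏ`. -/
theorem exists_interval_cover (hA : ∀ i j, A i j = 0 ∨ A i j = 1)
    (h : A *ᵥ v = ρ • v) {C : ℝ} (hC : ∀ i, 1 ≤ C * v i) (k : ℕ) :
    ∃ T : Fin N → Finset ℝ, (∀ i, ((T i).card : ℝ) ≤ C * v i * ρ ^ k) ∧
      ∀ x ∈ admissible A, ∃ t ∈ T (x 0), Real.ofDigits x ∈ Set.Icc t (t + ((N : ℝ) ^ k)⁻¹) := by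
  classical
  induction k with
  | zero =>
    refine ⟨fun _ => {0}, fun i => by simpa using hC i, fun x _ => ⟨0, by simp, ?_⟩⟩
    simpa using ⟨Real.ofDigits_nonneg x, Real.ofDigits_le_one x⟩
  | succ k ih =>
    obtain ⟨T, hcard, hcov⟩ := ih
    -- Words starting with `i` are covered by the contracted intervals of the letters `j` allowed
    -- after `i`; the eigenvector equation then multiplies the count by `ρ`.
    refine ⟨fun i => (Finset.univ.filter fun j => A i j = 1).biUnion fun j =>
      (T j).image fun t => (N : ℝ)⁻¹ * (i + t), fun i => ?_, fun x hx => ?_⟩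
    · calc (_ : ℝ) ≤ ((∑ j with A i j = 1, (T j).card : ℕ) : ℝ) := by
            exact_mod_cast Finset.card_biUnion_le.trans
              (Finset.sum_le_sum fun j _ => Finset.card_image_le)
        _ ≤ ∑ j with A i j = 1, C * v j * ρ ^ k := by
            push_cast
            exact Finset.sum_le_sum fun j _ => hcard j
        _ = ∑ j, C * ρ ^ k * (A i j * v j) := by
            rw [Finset.sum_filter]
            refine Finset.sum_congr rfl fun j _ => ?_
            rcases hA i j with h0 | h1
            · simp [h0]
            · simp only [h1, if_true]
              ring
        _ = C * v i * ρ ^ (k + 1) := by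
            have hi : ∑ j, A i j * v j = ρ * v i := congrFun h i
            rw [← Finset.mul_sum, hi]
            ring
    · obtain ⟨t, ht, htx⟩ := hcov (fun n => x (n + 1)) fun n => hx (n + 1)
      refine ⟨(N : ℝ)⁻¹ * (x 0 + t), ?_, ?_⟩
      · simp only [Finset.mem_biUnion, Finset.mem_filter, Finset.mem_univ, true_and,
          Finset.mem_image]
        exact ⟨x 1, hx 0, t, ht, rfl⟩
      · have hxc : cons (x 0) (fun n => x (n + 1)) = x := by
          ext n
          cases n <;> rfl
        have hN : (0 : ℝ) ≤ (N : ℝ)⁻¹ := by positivity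
        rw [← hxc, ofDigits_cons, pow_succ', mul_inv]
        constructor
        · exact mul_le_mul_of_nonneg_left (by simpa [cons] using htx.1) hN
        · rw [← mul_add]
          refine mul_le_mul_of_nonneg_left ?_ hN
          have := htx.2
          simp only [cons]
          linarith

theorem hausdorffMeasure_range_ne_top (hA : ∀ i j, A i j = 0 ∨ A i j = 1) (hN : 1 < N)
    (hρ : 1 < ρ) {d : ℝ} (hNd : (N : ℝ) ^ d = ρ) (hv : ∀ i, 0 < v i)
    (hsum : ∑ i, v i = 1) (h : A *ᵥ v = ρ • v) :
    Measure.hausdorffMeasure d (Set.range (toReal A)) ≠ ∞ := by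
  classical
  have hN0 : (0 : ℝ) < N := by positivity
  have hρ0 : 0 < ρ := by linarith
  -- This makes `C * v i ≥ 1`, which allows one interval per letter at level zero.
  set C : ℝ := ∑ i, (v i)⁻¹
  have hC : ∀ i, 1 ≤ C * v i := fun i => by
    have : (v i)⁻¹ ≤ C := Finset.single_le_sum (f := fun i => (v i)⁻¹)
      (fun j _ => (inv_pos.2 (hv j)).le) (Finset.mem_univ i)
    calc (1 : ℝ) = (v i)⁻¹ * v i := (inv_mul_cancel₀ (hv i).ne').symm
      _ ≤ C * v i := mul_le_mul_of_nonneg_right this (hv i).le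
  choose T hcard hcov using exists_interval_cover hA h hC
  have hdiam : ∀ (k : ℕ) (t : ℝ), Metric.ediam (Set.Icc t (t + ((N : ℝ) ^ k)⁻¹)) =
      ENNReal.ofReal (((N : ℝ)⁻¹) ^ k) := fun k t => by
    rw [Real.ediam_Icc, add_sub_cancel_left, inv_pow]
  have hbound := Measure.hausdorffMeasure_le_liminf_sum
    (ι := fun k => (Finset.univ.biUnion (T k) : Finset ℝ)) d (Set.range (toReal A)) (l := atTop)
    (fun k : ℕ => ENNReal.ofReal (((N : ℝ)⁻¹) ^ k)) ?_
    (fun k t => Set.Icc (t : ℝ) (t + ((N : ℝ) ^ k)⁻¹))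
    (Eventually.of_forall fun k t => (hdiam k t).le) (Eventually.of_forall fun k => ?_)
  · refine (hbound.trans_lt (lt_of_le_of_lt (liminf_le_liminf
      (v := fun _ => ENNReal.ofReal C) (Eventually.of_forall fun k => ?_)) ?_)).ne
    · simp only [hdiam, Finset.sum_const, Finset.card_univ, Fintype.card_coe, nsmul_eq_mul]
      have hpow : (((N : ℝ)⁻¹) ^ k) ^ d = (ρ⁻¹) ^ k := by
        rw [← hNd, ← Real.inv_rpow hN0.le, ← Real.rpow_natCast, ← Real.rpow_natCast,
          ← Real.rpow_mul (by positivity), ← Real.rpow_mul (by positivity), mul_comm]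
      rw [ENNReal.ofReal_rpow_of_pos (by positivity), hpow, ← ENNReal.ofReal_natCast,
        ← ENNReal.ofReal_mul (by positivity)]
      refine ENNReal.ofReal_le_ofReal ?_
      calc _ ≤ (∑ i, C * v i * ρ ^ k) * ρ⁻¹ ^ k := by
            refine mul_le_mul_of_nonneg_right ?_ (by positivity)
            refine le_trans ?_ (Finset.sum_le_sum fun i _ => hcard k i)
            exact_mod_cast Finset.card_biUnion_le
        _ = C := by
            rw [← Finset.sum_mul, ← Finset.mul_sum, hsum, mul_one, mul_assoc, ← mul_pow,
              mul_inv_cancel₀ hρ0.ne', one_pow, mul_one]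
    · rw [liminf_const]
      exact ENNReal.ofReal_lt_top
  · rw [← ENNReal.ofReal_zero]
    exact ENNReal.tendsto_ofReal (tendsto_pow_atTop_nhds_zero_of_lt_one (by positivity)
      (inv_lt_one_of_one_lt₀ (by exact_mod_cast hN)))
  · rw [range_toReal]
    rintro _ ⟨x, hx, rfl⟩
    obtain ⟨t, ht, htx⟩ := hcov k x hx
    exact Set.mem_iUnion.2 ⟨⟨t, Finset.mem_biUnion.2 ⟨x 0, Finset.mem_univ _, ht⟩⟩, htx⟩

theorem hausdorffDim_eq {d : ℝ} (hd : 0 ≤ d)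
    (h0 : Measure.hausdorffMeasure d (Set.range (toReal A)) ≠ 0)
    (htop : Measure.hausdorffMeasure d (Set.range (toReal A)) ≠ ∞) : hausdorffDim A = d := by
  lift d to NNReal using hd
  rw [hausdorffDim, dimH_of_hausdorffMeasure_ne_zero_ne_top h0 htop, ENNReal.coe_toReal]

end Dimension

/-! ### Measurability, self-similarity and the invariant density. -/

section HausdorffMeasure

variable {N : ℕ} {A : Matrix (Fin N) (Fin N) ℝ}

theorem hausdorffOuterMeasure_apply (s : Set (Subshift A)) : hausdorffOuterMeasure A s =
    Measure.hausdorffMeasure (hausdorffDim A) (toReal A '' s) :=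
  OuterMeasure.comap_apply _ _ _

theorem isCaratheodory_preimage_toReal {E : Set ℝ} (hE : MeasurableSet E) :
    (hausdorffOuterMeasure A).IsCaratheodory (toReal A ⁻¹' E) := fun t => by
  simp only [hausdorffOuterMeasure_apply]
  rw [Set.image_inter_preimage, Set.sdiff_eq, ← Set.preimage_compl, Set.image_inter_preimage,
    ← Set.sdiff_eq, measure_inter_add_sdiff _ hE]

theorem isCaratheodory_of_null {s : Set (Subshift A)} (hs : hausdorffOuterMeasure A s = 0) :
    (hausdorffOuterMeasure A).IsCaratheodory s := by
  rw [OuterMeasure.isCaratheodory_iff_le']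
  intro t
  rw [measure_mono_null Set.inter_subset_right hs, zero_add]
  exact measure_mono Set.sdiff_subset

/-- Away from the grid points the condition is the preimage of a Borel set of reals. The exceptional
words are null because their realizations are countably many and the dimension is positive. -/
theorem isCaratheodory_letter (hN : N ≠ 0) (hd : 0 < hausdorffDim A) (k : ℕ) (i : Fin N) :
    (hausdorffOuterMeasure A).IsCaratheodory {x | x.1 k = i} := by
  set D : Set (Subshift A) := toReal A ⁻¹' gridPoints N
  have hD : hausdorffOuterMeasure A D = 0 := by
    have := Measure.nullSingletonClass_hausdorff ℝ hd
    rw [hausdorffOuterMeasure_apply]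
    exact measure_mono_null (Set.image_preimage_subset _ _)
      ((countable_gridPoints hN).measure_zero _)
  set E : Set ℝ := {y | ⌊(N : ℝ) ^ (k + 1) * y⌋₊ % N = i}
  have hE : MeasurableSet E := by
    have : Measurable fun y : ℝ => ⌊(N : ℝ) ^ (k + 1) * y⌋₊ :=
      Nat.measurable_floor.comp (measurable_const_mul _)
    exact this (MeasurableSet.of_discrete (s := {m : ℕ | m % N = i}))
  have hmem : ∀ x ∉ D, toReal A x ∈ E ↔ x.1 k = i := fun x hx => by
    simp only [E, toReal, Set.mem_ofPred_eq]
    rw [floor_pow_mul_ofDigits x.1 hx, code_succ_mod, Fin.ext_iff]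
  have : {x : Subshift A | x.1 k = i} = (toReal A ⁻¹' E ∩ Dᶜ) ∪ ({x | x.1 k = i} ∩ D) := by
    ext x
    by_cases hx : x ∈ D
    · simp [hx]
    · simp [hx, hmem x hx]
  rw [this]
  refine OuterMeasure.isCaratheodory_union _ (OuterMeasure.isCaratheodory_inter _
    (isCaratheodory_preimage_toReal hE) (OuterMeasure.isCaratheodory_compl _
      (isCaratheodory_of_null hD))) (isCaratheodory_of_null ?_)
  exact measure_mono_null Set.inter_subset_right hD

/-- In dimension zero countable sets need not be null, so the case `N = 1` is separate: there is
then at most one word. -/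
theorem measurableSpace_le_caratheodory (h : N = 1 ∨ N ≠ 0 ∧ 0 < hausdorffDim A) :
    (inferInstance : MeasurableSpace (Subshift A)) ≤ (hausdorffOuterMeasure A).caratheodory := by
  rcases h with rfl | ⟨hN, hd⟩
  · intro s _
    have : Subsingleton (Subshift A) := inferInstance
    induction s using Subsingleton.set_cases with
    | h0 => exact (hausdorffOuterMeasure A).caratheodory.measurableSet_empty
    | h1 => exact @MeasurableSet.univ _ (hausdorffOuterMeasure A).caratheodory
  · have hm : @Measurable _ _ (hausdorffOuterMeasure A).caratheodory _
        (Subtype.val : Subshift A → ℕ → Fin N) := by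
      let _ := (hausdorffOuterMeasure A).caratheodory
      refine measurable_pi_lambda _ fun k => measurable_to_countable' fun i => ?_
      exact isCaratheodory_letter hN hd k i
    exact measurable_iff_comap_le.1 hm

theorem hausdorffMeasure_apply (h : N = 1 ∨ N ≠ 0 ∧ 0 < hausdorffDim A) {s : Set (Subshift A)}
    (hs : MeasurableSet s) : hausdorffMeasure A s =
      Measure.hausdorffMeasure (hausdorffDim A) (toReal A '' s) := by
  rw [hausdorffMeasure, dif_pos (measurableSpace_le_caratheodory h), toMeasure_apply _ _ hs,
    hausdorffOuterMeasure_apply]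

theorem measurable_shift : Measurable (shift A) := by
  have h : Measurable fun (x : Subshift A) (n : ℕ) => x.1 (n + 1) :=
    measurable_pi_lambda _ fun n => (measurable_pi_apply (n + 1)).comp measurable_subtype_coe
  exact h.subtype_mk

theorem measurableSet_first_letter (p : Fin N → Prop) :
    MeasurableSet {x : Subshift A | p (x.1 0)} :=
  measurable_subtype_coe (measurableSet_letter 0 p)

theorem measurableSet_cylinder (i : Fin N) : MeasurableSet (cylinder A i) :=
  measurableSet_first_letter (· = i)

-- This self-similarity holds exactly, not just up to null sets, even though the realization need
-- not be injective.
open scoped Pointwise in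
theorem toReal_image_shift_preimage (B : Set (Subshift A)) (i : Fin N) :
    toReal A '' (shift A ⁻¹' B ∩ cylinder A i) =
      (N : ℝ)⁻¹ • ((fun y => (i : ℝ) + y) '' (toReal A '' (B ∩ {x | A i (x.1 0) = 1}))) := by
  ext y
  simp only [← Set.image_smul, Set.image_image, Set.mem_image, smul_eq_mul]
  constructor
  · rintro ⟨x, ⟨hxB, rfl⟩, rfl⟩
    refine ⟨shift A x, ⟨hxB, x.2 0⟩, ?_⟩
    rw [toReal, ← ofDigits_cons, toReal]
    congr 1
    ext n
    cases n <;> rfl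
  · rintro ⟨x, ⟨hxB, hx⟩, rfl⟩
    refine ⟨⟨cons i x.1, cons_mem_admissible x.2 hx⟩, ⟨hxB, rfl⟩, ?_⟩
    rw [toReal, ofDigits_cons, toReal]

theorem hausdorffMeasure_shift_preimage (h : N = 1 ∨ N ≠ 0 ∧ 0 < hausdorffDim A)
    {B : Set (Subshift A)} (hB : MeasurableSet B) (i : Fin N) :
    hausdorffMeasure A (shift A ⁻¹' B ∩ cylinder A i) =
      ENNReal.ofReal ((N : ℝ) ^ hausdorffDim A)⁻¹ *
        hausdorffMeasure A (B ∩ {x | A i (x.1 0) = 1}) := by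
  have hN : (0 : ℝ) < N := by
    have := Fin.pos i
    positivity
  have hd : 0 ≤ hausdorffDim A := ENNReal.toReal_nonneg
  rw [hausdorffMeasure_apply h ((measurable_shift hB).inter (measurableSet_cylinder i)),
    hausdorffMeasure_apply h (hB.inter (measurableSet_first_letter fun j => A i j = 1)),
    toReal_image_shift_preimage,
    Measure.hausdorffMeasure_smul₀ hd (inv_ne_zero hN.ne'),
    (isometry_add_left (i : ℝ)).hausdorffMeasure_image (Or.inl hd),
    ENNReal.smul_def, smul_eq_mul]
  congr 1
  rw [← Real.inv_rpow hN.le, ← ENNReal.ofReal_coe_nnreal]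
  congr 1
  push_cast
  rw [norm_inv, Real.norm_of_nonneg hN.le]

theorem muA_shift_preimage (h : N = 1 ∨ N ≠ 0 ∧ 0 < hausdorffDim A)
    {B : Set (Subshift A)} (hB : MeasurableSet B) (i : Fin N) :
    muA A (shift A ⁻¹' B ∩ cylinder A i) =
      ENNReal.ofReal ((N : ℝ) ^ hausdorffDim A)⁻¹ * muA A (B ∩ {x | A i (x.1 0) = 1}) := by
  simp only [muA, Measure.smul_apply, smul_eq_mul, hausdorffMeasure_shift_preimage h hB]
  ring

theorem muA_eq_sum_cylinder (B : Set (Subshift A)) (hB : MeasurableSet B) (p : Fin N → Prop)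
    [DecidablePred p] :
    muA A (B ∩ {x | p (x.1 0)}) = ∑ i with p i, muA A (B ∩ cylinder A i) := by
  rw [← measure_biUnion_finset]
  · congr 1
    ext x
    simp [cylinder, and_comm]
  · intro i _ j _ hij
    exact Set.disjoint_left.2 fun x hx hx' => hij (hx.2.symm.trans hx'.2)
  · exact fun j _ => hB.inter (measurableSet_cylinder j)

/-- Each of the `N` inverse branches contributes at most `N^(-δ)` times the measure. This domination
gives the boundedness of `T_σ`. -/
theorem map_shift_muA_le (h : N = 1 ∨ N ≠ 0 ∧ 0 < hausdorffDim A) :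
    (muA A).map (shift A) ≤
      (∑ _i : Fin N, ENNReal.ofReal ((N : ℝ) ^ hausdorffDim A)⁻¹) • muA A := by
  classical
  refine Measure.le_iff.2 fun B hB => ?_
  rw [Measure.map_apply measurable_shift hB, Measure.smul_apply, smul_eq_mul]
  have := muA_eq_sum_cylinder _ (measurable_shift hB) fun _ => True
  simp only [Set.ofPred_true, Set.inter_univ, Finset.filter_true] at this
  rw [this, Finset.sum_mul]
  refine Finset.sum_le_sum fun i _ => ?_
  rw [muA_shift_preimage h hB]
  gcongr
  exact Set.inter_subset_left

/-- The measure with density `∑ᵢ ωᵢ χ_{R_i}` with respect to `μ_A`. -/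
noncomputable def weightedMeasure (A : Matrix (Fin N) (Fin N) ℝ) (ω : Fin N → ℝ) :
    Measure (Subshift A) :=
  ∑ i, ENNReal.ofReal (ω i) • (muA A).restrict (cylinder A i)

theorem weightedMeasure_apply (ω : Fin N → ℝ) {B : Set (Subshift A)} (hB : MeasurableSet B) :
    weightedMeasure A ω B = ∑ i, ENNReal.ofReal (ω i) * muA A (B ∩ cylinder A i) := by
  simp only [weightedMeasure, Measure.coe_finsetSum, Finset.sum_apply, Measure.smul_apply,
    smul_eq_mul, Measure.restrict_apply hB]

/-- The shift preserves the measure with density `∑ᵢ ωᵢ χ_{R_i}`. -/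
theorem map_shift_weightedMeasure (hA : ∀ i j, A i j = 0 ∨ A i j = 1)
    (h : N = 1 ∨ N ≠ 0 ∧ 0 < hausdorffDim A) {ρ : ℝ} (hρ : 0 < ρ)
    (hNd : (N : ℝ) ^ hausdorffDim A = ρ) {ω : Fin N → ℝ} (hω : ∀ i, 0 ≤ ω i)
    (hAω : Aᵀ *ᵥ ω = ρ • ω) :
    (weightedMeasure A ω).map (shift A) = weightedMeasure A ω := by
  classical
  ext B hB
  rw [Measure.map_apply measurable_shift hB, weightedMeasure_apply ω (measurable_shift hB),
    weightedMeasure_apply ω hB]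
  have hsum := fun i => muA_eq_sum_cylinder B hB fun j => A i j = 1
  simp_rw [muA_shift_preimage h hB, hNd, hsum, Finset.mul_sum, Finset.sum_filter]
  -- After the exchange, the coefficient of the mass of `B ∩ R_j` is `ρ⁻¹ (Aᵀω) j = ω j`.
  rw [Finset.sum_comm]
  refine Finset.sum_congr rfl fun j _ => ?_
  have hj : ∑ i, A i j * ω i = ρ * ω j := congrFun hAω j
  calc _ = ∑ i, ENNReal.ofReal (ρ⁻¹ * (A i j * ω i)) * muA A (B ∩ cylinder A j) := by
        refine Finset.sum_congr rfl fun i _ => ?_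
        rcases hA i j with h0 | h1
        · simp [h0]
        · rw [if_pos h1, h1, one_mul, ENNReal.ofReal_mul (by positivity)]
          ring
    _ = _ := by
        rw [← Finset.sum_mul, ← ENNReal.ofReal_sum_of_nonneg, ← Finset.mul_sum, hj,
          inv_mul_cancel_left₀ hρ.ne']
        intro i _
        rcases hA i j with h0 | h1
        · simp [h0]
        · rw [h1, one_mul]
          exact mul_nonneg (by positivity) (hω i)

theorem isProbabilityMeasure_muA (h : N = 1 ∨ N ≠ 0 ∧ 0 < hausdorffDim A)
    (h0 : Measure.hausdorffMeasure (hausdorffDim A) (Set.range (toReal A)) ≠ 0)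
    (htop : Measure.hausdorffMeasure (hausdorffDim A) (Set.range (toReal A)) ≠ ∞) :
    IsProbabilityMeasure (muA A) := by
  constructor
  rw [muA, Measure.smul_apply, smul_eq_mul, hausdorffMeasure_apply h MeasurableSet.univ,
    Set.image_univ, ENNReal.inv_mul_cancel h0 htop]

end HausdorffMeasure

/-! ### The composition operator and its adjoint. -/

section Operator

/-- Change of variables gives `‖ψ ∘ σ‖ ≤ K^(1/2) ‖ψ‖`, and domination also makes composition
independent of representatives. -/
theorem exists_isCompositionOperator {X : Type*} [MeasurableSpace X] {μ : Measure X} {σ : X → X}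
    (hσ : Measurable σ) {K : ℝ≥0∞} (hK : K ≠ ∞) (h : μ.map σ ≤ K • μ) :
    ∃ T, IsCompositionOperator μ σ T := by
  have hq : Measure.QuasiMeasurePreserving σ μ μ :=
    ⟨hσ, (Measure.absolutelyContinuous_of_le h).trans Measure.smul_absolutelyContinuous⟩
  have hmem : ∀ ψ : Lp ℂ 2 μ, MemLp (ψ ∘ σ) 2 μ := fun ψ =>
    (MemLp.of_measure_le_smul hK h (Lp.memLp ψ)).comp_of_map hσ.aemeasurable
  let L : Lp ℂ 2 μ →ₗ[ℂ] Lp ℂ 2 μ :=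
    { toFun := fun ψ => (hmem ψ).toLp _
      map_add' := fun ψ φ => by
        rw [← MemLp.toLp_add, MemLp.toLp_eq_toLp_iff]
        exact hq.ae_eq_comp (Lp.coeFn_add ψ φ)
      map_smul' := fun c ψ => by
        rw [RingHom.id_apply, ← MemLp.toLp_const_smul, MemLp.toLp_eq_toLp_iff]
        exact hq.ae_eq_comp (Lp.coeFn_smul c ψ) }
  refine ⟨L.mkContinuous (K ^ (1 / (2 : ℝ≥0∞)).toReal).toReal fun ψ => ?_, hq, fun ψ =>
    (hmem ψ).coeFn_toLp⟩
  change ‖(hmem ψ).toLp _‖ ≤ _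
  rw [Lp.norm_toLp, Lp.norm_def, ← ENNReal.toReal_mul]
  refine ENNReal.toReal_mono (ENNReal.mul_ne_top
    (ENNReal.rpow_ne_top_of_nonneg ENNReal.toReal_nonneg hK) (Lp.eLpNorm_ne_top ψ)) ?_
  rw [← eLpNorm_map_measure ((Lp.aestronglyMeasurable ψ).mono_ac hq.absolutelyContinuous)
    hσ.aemeasurable]
  refine (eLpNorm_mono_measure _ h).trans_eq ?_
  rw [eLpNorm_smul_measure_of_ne_top (by simp), smul_eq_mul]

theorem isCompositionOperator_compositionOperator {X : Type*} [MeasurableSpace X] {μ : Measure X}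
    {σ : X → X} (h : ∃ T, IsCompositionOperator μ σ T) :
    IsCompositionOperator μ σ (compositionOperator μ σ) := by
  rw [compositionOperator, dif_pos h]
  exact h.choose_spec

variable {N : ℕ} {A : Matrix (Fin N) (Fin N) ℝ}

theorem measurable_cylinderSum (ω : Fin N → ℝ) : Measurable (cylinderSum A ω) :=
  Finset.measurable_fun_sum _ fun i _ =>
    measurable_const.mul (measurable_one.indicator (measurableSet_cylinder i))

theorem cylinderSum_apply (ω : Fin N → ℝ) (x : Subshift A) : cylinderSum A ω x = ω (x.1 0) := by
  rw [cylinderSum, Finset.sum_eq_single (x.1 0)]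
  · simp [cylinder]
  · intro i _ hi
    simp [cylinder, hi.symm]
  · simp

theorem memLp_cylinderSum [IsFiniteMeasure (muA A)] (ω : Fin N → ℝ) :
    MemLp (cylinderSum A ω) 2 (muA A) := by
  refine MemLp.of_bound (measurable_cylinderSum ω).aestronglyMeasurable (∑ i, ‖(ω i : ℂ)‖)
    (Filter.Eventually.of_forall fun x => ?_)
  rw [cylinderSum_apply]
  exact Finset.single_le_sum (f := fun i => ‖(ω i : ℂ)‖) (fun i _ => norm_nonneg _)
    (Finset.mem_univ (x.1 0))

theorem integral_weightedMeasure {ω : Fin N → ℝ} (hω : ∀ i, 0 ≤ ω i) {g : Subshift A → ℂ}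
    (hg : Integrable g (muA A)) :
    ∫ x, g x ∂weightedMeasure A ω = ∫ x, g x * cylinderSum A ω x ∂muA A := by
  have hfun : (fun x => g x * cylinderSum A ω x) =
      fun x => ∑ i, (cylinder A i).indicator (fun x => (ω i : ℂ) * g x) x := by
    ext x
    rw [cylinderSum, Finset.mul_sum]
    refine Finset.sum_congr rfl fun i _ => ?_
    by_cases hx : x ∈ cylinder A i
    · simp only [Set.indicator_of_mem hx, Pi.one_apply]
      ring
    · simp [Set.indicator_of_notMem hx]
  rw [hfun, integral_finsetSum _ fun i _ =>
    (hg.const_mul _).indicator (measurableSet_cylinder i), weightedMeasure,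
    integral_finsetSum_measure fun i _ => hg.restrict.smul_measure ENNReal.ofReal_ne_top]
  refine Finset.sum_congr rfl fun i _ => ?_
  rw [integral_smul_measure, integral_indicator (measurableSet_cylinder i),
    integral_const_mul, ENNReal.toReal_ofReal (hω i), Complex.real_smul]

theorem weightedMeasure_absolutelyContinuous (ω : Fin N → ℝ) :
    weightedMeasure A ω ≪ muA A := by
  refine Measure.AbsolutelyContinuous.mk fun s hs h0 => ?_
  rw [weightedMeasure_apply ω hs]
  refine Finset.sum_eq_zero fun i _ => ?_
  rw [measure_mono_null Set.inter_subset_left h0, mul_zero]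

/-- Pairing `ψ` with `f` integrates `conj ψ` against the weighted measure, and the adjoint replaces
`ψ` by `ψ ∘ σ`, so invariance of that measure is the fixed-point equation in weak form. -/
theorem perronFrobeniusOperator_cylinderSum [IsFiniteMeasure (muA A)] {ω : Fin N → ℝ}
    (hω : ∀ i, 0 ≤ ω i)
    (hcomp : IsCompositionOperator (muA A) (shift A) (compositionOperator (muA A) (shift A)))
    (hinv : (weightedMeasure A ω).map (shift A) = weightedMeasure A ω)
    (hf : MemLp (cylinderSum A ω) 2 (muA A)) :
    perronFrobeniusOperator (muA A) (shift A) (hf.toLp (cylinderSum A ω)) =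
      hf.toLp (cylinderSum A ω) := by
  refine ext_inner_left ℂ fun ψ => ?_
  have hint : ∀ φ : Lp ℂ 2 (muA A), Integrable (fun x => (starRingEnd ℂ) (φ x)) (muA A) :=
    fun φ => (Lp.memLp φ).star.integrable (by norm_num)
  have hinner : ∀ φ : Lp ℂ 2 (muA A), inner ℂ φ (hf.toLp (cylinderSum A ω)) =
      ∫ x, (starRingEnd ℂ) (φ x) ∂weightedMeasure A ω := fun φ => by
    rw [integral_weightedMeasure hω (hint φ), L2.inner_def]
    refine integral_congr_ae ?_
    filter_upwards [hf.coeFn_toLp] with x hx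
    rw [hx, RCLike.inner_apply, mul_comm]
  have hac := weightedMeasure_absolutelyContinuous (A := A) ω
  rw [perronFrobeniusOperator, ContinuousLinearMap.adjoint_inner_right, hinner, hinner]
  calc _ = ∫ x, (starRingEnd ℂ) (ψ (shift A x)) ∂weightedMeasure A ω := by
        refine integral_congr_ae ?_
        filter_upwards [hac.ae_le (hcomp.2 ψ)] with x hx
        rw [hx]
    _ = ∫ x, (starRingEnd ℂ) (ψ x) ∂(weightedMeasure A ω).map (shift A) := by
        rw [integral_map measurable_shift.aemeasurable]
        rw [hinv]
        exact (hint ψ).aestronglyMeasurable.mono_ac hac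
    _ = _ := by rw [hinv]

end Operator

/-! ### Identification of the dimension. -/

section HausdorffDimension

variable {N : ℕ} {A : Matrix (Fin N) (Fin N) ℝ}

/-- The Hausdorff measure of `Λ_A` in its dimension is positive and finite, and `N ^ δ_A` is the
Perron–Frobenius eigenvalue. -/
theorem hausdorffMeasure_range_hausdorffDim (hA : ∀ i j, A i j = 0 ∨ A i j = 1) {n : ℕ}
    (hn : 0 < n) (hpos : ∀ i j, 0 < (A ^ n) i j) {ρ : ℝ} (hρ : 0 < ρ) {ω : Fin N → ℝ}
    (hω0 : ω ≠ 0) (hω : ∀ i, 0 < ω i) (h : Aᵀ *ᵥ ω = ρ • ω) :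
    (N = 1 ∨ N ≠ 0 ∧ 0 < hausdorffDim A) ∧ (N : ℝ) ^ hausdorffDim A = ρ ∧
      Measure.hausdorffMeasure (hausdorffDim A) (Set.range (toReal A)) ≠ 0 ∧
      Measure.hausdorffMeasure (hausdorffDim A) (Set.range (toReal A)) ≠ ∞ := by
  have hrow := exists_eq_one_of_pow_pos hA hn hpos
  obtain ⟨i, -⟩ := Function.ne_iff.1 hω0
  -- For `N = 1` the logarithm to base `N` is of no use, but `Λ_A` is a single word, of dimension
  -- `0` and measure `1`, and `ρ = 1`.
  rcases (Nat.succ_le_of_lt (Fin.pos i)).eq_or_lt' with rfl | hN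
  · obtain ⟨x, hx, -⟩ := exists_mem_admissible hrow i
    have hsub : (Set.range (toReal A)).Subsingleton := Set.subsingleton_range _
    have hdim : hausdorffDim A = 0 := by simp [hausdorffDim, dimH_subsingleton hsub]
    have hne : (Set.range (toReal A)).Nonempty := ⟨_, ⟨x, hx⟩, rfl⟩
    rw [hdim]
    refine ⟨Or.inl rfl, ?_,
      (one_pos.trans_le (Measure.one_le_hausdorffMeasure_zero_of_nonempty hne)).ne',
      ((Measure.hausdorffMeasure_le_one_of_subsingleton hsub le_rfl).trans_lt
        ENNReal.one_lt_top).ne⟩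
    obtain ⟨j, hj⟩ := hrow i
    have hi : ∑ j, A j i * ω j = ρ * ω i := congrFun h i
    rw [Subsingleton.elim j i] at hj
    rw [Fintype.sum_subsingleton _ i, hj] at hi
    rw [Real.rpow_zero]
    exact mul_right_cancel₀ (hω i).ne' hi
  · have hA0 : ∀ i j, 0 ≤ A i j := fun i j => (hA i j).elim (fun h => h.ge) fun h => by simp [h]
    obtain ⟨v, hv, hsum, hAv⟩ := exists_pos_eigenvector hA0 hn hpos hω0 hω hρ.le h
    have hρ1 := one_lt_of_mulVec_eq hA hpos hN hρ.le hv hAv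
    have hN1 : (1 : ℝ) < N := by exact_mod_cast hN
    have hd : 0 < Real.logb N ρ := Real.logb_pos hN1 hρ1
    have hNd : (N : ℝ) ^ Real.logb N ρ = ρ :=
      Real.rpow_logb (by linarith) hN1.ne' hρ
    have h0 := hausdorffMeasure_range_ne_zero hA hrow hN hρ1 hd hNd hv hsum hAv
    have htop := hausdorffMeasure_range_ne_top hA hN hρ1 hNd hv hsum hAv
    rw [hausdorffDim_eq hd.le h0 htop]
    exact ⟨Or.inr ⟨by omega, hd⟩, hNd, h0, htop⟩

end HausdorffDimension

end CuntzKrieger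

theorem proposition2p18 (N : ℕ) (A : Matrix (Fin N) (Fin N) ℝ)
    (hA : ∀ i j, A i j = 0 ∨ A i j = 1)
    (hirr : ∃ n : ℕ, 0 < n ∧ ∀ i j, 0 < (A ^ n) i j)
    (ω : Fin N → ℝ) (hω : CuntzKrieger.IsPerronFrobeniusEigenvector Aᵀ ω) :
    IsProbabilityMeasure (CuntzKrieger.muA A) ∧
    CuntzKrieger.IsCompositionOperator (CuntzKrieger.muA A) (CuntzKrieger.shift A)
      (CuntzKrieger.compositionOperator (CuntzKrieger.muA A) (CuntzKrieger.shift A)) ∧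
    ∃ hf : MemLp (CuntzKrieger.cylinderSum A ω) 2 (CuntzKrieger.muA A),
      CuntzKrieger.perronFrobeniusOperator (CuntzKrieger.muA A) (CuntzKrieger.shift A)
        (hf.toLp (CuntzKrieger.cylinderSum A ω)) = hf.toLp (CuntzKrieger.cylinderSum A ω) := by
  obtain ⟨n, hn, hpos⟩ := hirr
  obtain ⟨hω0, hω1, hAω⟩ := hω
  have hposT : ∀ i j, 0 < (Aᵀ ^ n) i j := fun i j => by
    rw [← Matrix.transpose_pow]
    exact hpos j i
  obtain ⟨hρ, hω2⟩ :=
    CuntzKrieger.pos_of_mulVec_eq hn hposT hω0 hω1 ENNReal.toReal_nonneg hAω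
  obtain ⟨hN, hNd, h0, htop⟩ :=
    CuntzKrieger.hausdorffMeasure_range_hausdorffDim hA hn hpos hρ hω0 hω2 hAω
  have hprob := CuntzKrieger.isProbabilityMeasure_muA hN h0 htop
  have hcomp := CuntzKrieger.isCompositionOperator_compositionOperator
    (CuntzKrieger.exists_isCompositionOperator CuntzKrieger.measurable_shift
      (by simp [ENNReal.mul_eq_top]) (CuntzKrieger.map_shift_muA_le hN))
  exact ⟨hprob, hcomp, CuntzKrieger.memLp_cylinderSum ω,
    CuntzKrieger.perronFrobeniusOperator_cylinderSum hω1 hcomp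
      (CuntzKrieger.map_shift_weightedMeasure hA hN hρ hNd hω1 hAω) _⟩
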